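/- Let $d\ge 0$, let $g_1,\dots,g_H$ be real polynomials in $x=(x_1,\dots,x_d)$, and suppose that $\Omega=\{x\in\mathbb{R}^d: g_1(x)\ge 0,\dots,g_H(x)\ge 0\}$ is compact with nonempty interior. Let $\mathcal{Q}(g)$ be the set of all polynomials $\sigma_0+\sum_{h=1}^H\sigma_h g_h$ with $\sigma_0,\dots,\sigma_H$ sums of squares of polynomials, and let $\mathcal{Q}(g)_t$ be the set of those that admit such a representation with $\deg\sigma_0\le 2t$ and $\deg(\sigma_h g_h)\le 2t$ for all $h$. Assume the Archimedean condition: $C-\|x\|_2^2\in\mathcal{Q}(g)$ for some $C>0$. Let $1\le n\le N$, let $\mathcal{P}_k$ be the space of $d$-variate real polynomials of total degree at most $k$, and let $f\in\mathcal{P}_N$. Put $$E=\inf_{p\in\mathcal{P}_{n-1}}\ \max_{x\in\Omega}|f(x)-p(x)|.$$ For $t\in\mathbb{N}$ let $$\mathrm{ub}_t=\inf\{c\in\mathbb{R}:\ \exists\,p\in\mathcal{P}_{n-1}\text{ with } c+f-p\in\mathcal{Q}(g)_t \text{ and } c-f+p\in\mathcal{Q}(g)_t\}\in[-\infty,+\infty].$$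 Let $n'_h=\lceil \deg(g_h)/2\rceil$. For a real family $y=(y_\ell)$ indexed by the multiindices $\ell\in\mathbb{N}_0^d$ with $|\ell|=\ell_1+\dots+\ell_d\le 2t$ (and $y_\ell=0$ for $|\ell|>2t$), let $\mathrm{Hank}_s(y)=(y_{i+j})_{|i|,|j|\le s}$ and let $(G_hy)_\ell=\sum_{\ell'}\mathrm{coeff}_{x^{\ell'}}(g_h)\,y_{\ell+\ell'}$. For $t\ge\max_h n'_h$ let $\mathrm{ub}'_t\in[-\infty,+\infty]$ be the supremum of $$\sum_{|\ell|\le N}\mathrm{coeff}_{x^\ell}(f)\,(y^+_\ell-y^-_\ell)$$ over all pairs $y^+,y^-$ of such families with $y^+_\ell=y^-_\ell$ for $|\ell|\le n-1$, with $y^+_0+y^-_0=1$, and with $\mathrm{Hank}_t(y^\pm)\succeq 0$ and $\mathrm{Hank}_{t-n'_h}(G_hy^\pm)\succeq 0$ for $h=1,\dots,H$. Then, for $t\ge N+\max_h n'_h$ (the maximum being $0$ if $H=0$), both $(\mathrm{ub}_t)$ and $(\mathrm{ub}'_t)$ are nonincreasing in $t$ and satisfy $E\le\mathrm{ub}_t$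 and $E\le\mathrm{ub}'_t$. Moreover $$\lim_{t\to\infty}\mathrm{ub}_t=\lim_{t\to\infty}\mathrm{ub}'_t=E.$$ -/

import Mathlib

open scoped Topology

namespace ChebyshevSOS

noncomputable section

/-- The uniform norm `‖q‖_Ω`, the supremum of `|q(x)|` over `x ∈ Ω`. -/
def uniformNorm {d : ℕ} (Ω : Set (Fin d → ℝ)) (q : MvPolynomial (Fin d) ℝ) : ℝ :=
  sSup ((fun x => |MvPolynomial.eval x q|) '' Ω)

/-- The error of best approximation to `f`, uniformly on `Ω`, by polynomials of total degree
at most `m`. -/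
def bestApproxError {d : ℕ} (m : ℕ) (f : MvPolynomial (Fin d) ℝ) (Ω : Set (Fin d → ℝ)) : ℝ :=
  sInf ((fun p => uniformNorm Ω (f - p)) ''
    (MvPolynomial.restrictTotalDegree (Fin d) ℝ m : Set (MvPolynomial (Fin d) ℝ)))

/-- The basic semialgebraic set described by the inequalities `g₁ ≥ 0, …, g_H ≥ 0`. -/
def semialgebraicSet {d H : ℕ} (g : Fin H → MvPolynomial (Fin d) ℝ) : Set (Fin d → ℝ) :=
  {x | ∀ h, 0 ≤ MvPolynomial.eval x (g h)}

/-- The quadratic module `Q(g₁, …, g_H)`. -/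
def quadraticModule {d H : ℕ} (g : Fin H → MvPolynomial (Fin d) ℝ) :
    Set (MvPolynomial (Fin d) ℝ) :=
  {p | ∃ (σ₀ : MvPolynomial (Fin d) ℝ) (σ : Fin H → MvPolynomial (Fin d) ℝ),
    IsSumSq σ₀ ∧ (∀ h, IsSumSq (σ h)) ∧ p = σ₀ + ∑ h, σ h * g h}

/-- The truncated quadratic module `Q(g₁, …, g_H)_t`: all terms have degree at most `2t`. -/
def truncatedQuadraticModule {d H : ℕ} (g : Fin H → MvPolynomial (Fin d) ℝ) (t : ℕ) :
    Set (MvPolynomial (Fin d) ℝ) :=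
  {p | ∃ (σ₀ : MvPolynomial (Fin d) ℝ) (σ : Fin H → MvPolynomial (Fin d) ℝ),
    IsSumSq σ₀ ∧ (∀ h, IsSumSq (σ h)) ∧
    σ₀.totalDegree ≤ 2 * t ∧ (∀ h, (σ h * g h).totalDegree ≤ 2 * t) ∧
    p = σ₀ + ∑ h, σ h * g h}

/-- The Archimedean condition: `C - ‖x‖₂²` belongs to the quadratic module for some `C > 0`. -/
def IsArchimedean {d H : ℕ} (g : Fin H → MvPolynomial (Fin d) ℝ) : Prop :=
  ∃ C : ℝ, 0 < C ∧
    MvPolynomial.C C - ∑ i, (MvPolynomial.X i : MvPolynomial (Fin d) ℝ) ^ 2 ∈ quadraticModule g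

/-- `⌈deg(q) / 2⌉`. -/
def halfDegree {d : ℕ} (q : MvPolynomial (Fin d) ℝ) : ℕ := (q.totalDegree + 1) / 2

/-- The value of the sum-of-squares program at level `t` (`⊤` if the program is infeasible):
minimize `c` over `c ∈ ℝ` and `p` of degree at most `n - 1` such that `c + f - p` and `c - f + p`
lie in the truncated quadratic module. -/
def ub {d H : ℕ} (g : Fin H → MvPolynomial (Fin d) ℝ) (n : ℕ) (f : MvPolynomial (Fin d) ℝ)
    (t : ℕ) : EReal :=
  sInf {v : EReal | ∃ (c : ℝ) (p : MvPolynomial (Fin d) ℝ),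
    p ∈ MvPolynomial.restrictTotalDegree (Fin d) ℝ (n - 1) ∧
    MvPolynomial.C c + f - p ∈ truncatedQuadraticModule g t ∧
    MvPolynomial.C c - f + p ∈ truncatedQuadraticModule g t ∧
    v = (c : EReal)}

/-- The Hankel matrix `Hank_t(y)`, of size `binom(t+d, d)`: the entry at `(i, j)` is `y_{i+j}`,
with `i, j` ranging over the multiindices of total degree at most `t`. -/
def hankel {d : ℕ} (t : ℕ) (y : (Fin d →₀ ℕ) → ℝ) :
    Matrix {i : Fin d →₀ ℕ // i.degree ≤ t} {i : Fin d →₀ ℕ // i.degree ≤ t} ℝ :=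
  Matrix.of fun i j => y (i.1 + j.1)

/-- The sequence `G y` associated with a polynomial `q`:
`(G y)_ℓ = ∑_{ℓ'} coeff_{ℓ'}(q) y_{ℓ+ℓ'}`. -/
def shift {d : ℕ} (q : MvPolynomial (Fin d) ℝ) (y : (Fin d →₀ ℕ) → ℝ) :
    (Fin d →₀ ℕ) → ℝ :=
  fun l => ∑ l' ∈ q.support, q.coeff l' * y (l + l')

/-- `y` is a vector of pseudo-moments of order `2t` (extended by zero to all multiindices)
satisfying the positive semidefiniteness constraints at level `t`. -/
def IsPseudoMoment {d H : ℕ} (g : Fin H → MvPolynomial (Fin d) ℝ) (t : ℕ)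
    (y : (Fin d →₀ ℕ) → ℝ) : Prop :=
  (∀ l, 2 * t < l.degree → y l = 0) ∧
  (hankel t y).PosSemidef ∧
  ∀ h, (hankel (t - halfDegree (g h)) (shift (g h) y)).PosSemidef

/-- The value of the moment program at level `t`, which is dual to `ub`
(`⊥` if the program is infeasible, `⊤` if it is unbounded). -/
def ub' {d H : ℕ} (g : Fin H → MvPolynomial (Fin d) ℝ) (n : ℕ) (f : MvPolynomial (Fin d) ℝ)
    (t : ℕ) : EReal :=
  sSup {v : EReal | ∃ yp ym : (Fin d →₀ ℕ) → ℝ,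
    (∀ l : Fin d →₀ ℕ, l.degree ≤ n - 1 → yp l - ym l = 0) ∧
    yp 0 + ym 0 = 1 ∧
    IsPseudoMoment g t yp ∧ IsPseudoMoment g t ym ∧
    v = ((∑ l ∈ f.support, f.coeff l * (yp l - ym l) : ℝ) : EReal)}

end

end ChebyshevSOS

/-!
The bounds `E ≤ ub` and the limit of `ub` rest on Putinar's Positivstellensatz: a polynomial that
is positive on `Ω` lies in `Q(g)` (`mem_quadraticModule_of_pos`). Given `c > E`, some `p` of degree
at most `n - 1` has `c ± (f - p) > 0` on `Ω`, so both polynomials lie in `Q(g)`, hence in `Q(g)_t`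
for all large `t`, and `ub_t ≤ c`. Conversely, membership in `Q(g)_t` implies nonnegativity on `Ω`.

The Positivstellensatz is obtained from a representation theorem for a quadratic module `M` in a
commutative real algebra that is archimedean, meaning that every element is bounded by a constant
modulo `M` (`exists_algHom_nonpos_of_notMem`). If `f ∉ M`, M. Riesz's extension theorem gives a
state, that is a normalized functional that is nonnegative on `M`, with value at most `0` at `f`.
The states form a compact convex set, so among those that minimize the value at `f` there is an
extreme one by the Krein–Milman lemma. Extreme states are multiplicative (`extreme_state_mul`), and
on polynomials a multiplicative state is the evaluation at a point of `Ω`.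

For the moment program, `ub' ≤ ub` by weak duality (`ub'_le_ub`), which uses that squares do not
cancel in their leading terms, so that an SOS certificate of degree `2t` only involves squares that
the Hankel matrices of order `t` control. The bound `E ≤ ub'` is the duality of best approximation:
Riesz's extension theorem on pairs of polynomials gives two functionals, positive on `Ω`, with total
mass `1`, equal in degree at most `n - 1`, and whose difference at `f` is at least `E`
(`exists_extremal_functionals`). Their truncated moment sequences are feasible at every level, and
monotonicity of `ub'` is likewise truncation of moment sequences.
-/

open scoped Topology

namespace ChebyshevSOS

/-! ### States of archimedean quadratic modules -/

/-- If `e` is an order unit of the cone `s` and `-e ∉ s`, then `s` has a nonnegative functional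
normalized at `e`: the extension of `c • e ↦ c` from the line through `e`. -/
theorem exists_positive_functional {V : Type*} [AddCommGroup V] [Module ℝ V]
    (s : PointedCone ℝ V) (e : V) (hunit : ∀ v, ∃ r : ℝ, r • e + v ∈ s) (he : -e ∉ s) :
    ∃ L : V →ₗ[ℝ] ℝ, L e = 1 ∧ ∀ v ∈ s, 0 ≤ L v := by
  have he0 : e ≠ 0 := by
    rintro rfl
    exact he (by simp)
  let φ : V →ₗ.[ℝ] ℝ := LinearPMap.mkSpanSingleton e (1 : ℝ) he0
  have hφ : ∀ (c : ℝ) (h : c • e ∈ φ.domain), φ ⟨c • e, h⟩ = c := by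
    intro c h
    have := LinearPMap.mkSpanSingleton'_apply (σ := RingHom.id ℝ) e (1 : ℝ)
      (fun c hc => by simpa [he0] using hc) c h
    rw [RingHom.id_apply, smul_eq_mul, mul_one] at this
    exact this
  have hmem : ∀ c : ℝ, c • e ∈ φ.domain := fun c =>
    Submodule.smul_mem _ _ (Submodule.mem_span_singleton_self e)
  obtain ⟨L, hL, hpos⟩ := riesz_extension s φ
    (by
      rintro ⟨x, hx⟩ hxs
      obtain ⟨c, rfl⟩ := Submodule.mem_span_singleton.1 hx
      rw [hφ]
      by_contra! hc
      refine he ?_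
      have h3 : (-c)⁻¹ • c • e ∈ s := s.smul_mem (inv_nonneg.2 (by linarith)) hxs
      rwa [smul_smul, inv_neg, neg_mul, inv_mul_cancel₀ hc.ne, neg_one_smul] at h3)
    (fun v => by
      obtain ⟨r, hr⟩ := hunit v
      exact ⟨⟨r • e, hmem r⟩, hr⟩)
  refine ⟨L, ?_, hpos⟩
  have := hL ⟨(1 : ℝ) • e, hmem 1⟩
  rw [hφ] at this
  simpa using this

section States

variable {A : Type*} [CommRing A] [Algebra ℝ A] (M : PointedCone ℝ A)

/-- The states of a cone `M` in a real algebra: the linear functionals that are nonnegative on `M`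
and normalized at `1`. They are kept as plain functions, so that the topology in which they form a
compact convex set is the product topology. -/
def states : Set (A → ℝ) :=
  {L | ∃ l : A →ₗ[ℝ] ℝ, ⇑l = L ∧ l 1 = 1 ∧ ∀ p ∈ M, 0 ≤ l p}

variable {M}

theorem isCompact_states (harch : ∀ a : A, ∃ c : ℝ, c • 1 - a ∈ M) : IsCompact (states M) := by
  choose N hN using harch
  refine (isCompact_univ_pi (s := fun a => Set.Icc (-N (-a)) (N a))
    (fun a => isCompact_Icc)).of_isClosed_subset ?_ ?_
  · have : states M = (⋂ (a : A) (b : A), {L | L (a + b) = L a + L b}) ∩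
        (⋂ (c : ℝ) (a : A), {L | L (c • a) = c * L a}) ∩ {L | L 1 = 1} ∩
        ⋂ p ∈ M, {L | 0 ≤ L p} := by
      ext L
      simp only [states, Set.mem_ofPred_eq, Set.mem_inter_iff, Set.mem_iInter]
      constructor
      · rintro ⟨l, rfl, h1, h2⟩
        exact ⟨⟨⟨fun a b => map_add l a b, fun c a => by simp⟩, h1⟩, h2⟩
      · rintro ⟨⟨⟨ha, hs⟩, h1⟩, h2⟩
        exact ⟨⟨⟨L, ha⟩, hs⟩, rfl, h1, h2⟩
    rw [this]
    refine ((IsClosed.inter ?_ ?_).inter ?_).inter ?_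
    · exact isClosed_iInter fun a => isClosed_iInter fun b =>
        isClosed_eq (continuous_apply _) (by fun_prop)
    · exact isClosed_iInter fun c => isClosed_iInter fun a =>
        isClosed_eq (continuous_apply _) (continuous_const.mul (continuous_apply _))
    · exact isClosed_eq (continuous_apply _) continuous_const
    · exact isClosed_iInter fun p => isClosed_iInter fun _ =>
        isClosed_le continuous_const (continuous_apply _)
  · rintro _ ⟨l, rfl, h1, h2⟩ a -
    have h3 := h2 _ (hN a)
    have h4 := h2 _ (hN (-a))
    simp only [map_sub, map_smul, h1, map_neg, smul_eq_mul, mul_one] at h3 h4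
    exact ⟨by linarith, by linarith⟩

/-- The Cauchy–Schwarz inequality for the form `(a, b) ↦ l (a b p)`. -/
theorem sq_mul_state_le (hsq : ∀ a, ∀ p ∈ M, a ^ 2 * p ∈ M) {l : A →ₗ[ℝ] ℝ}
    (hl : ∀ p ∈ M, 0 ≤ l p) {p : A} (hp : p ∈ M) (a : A) :
    l (a * p) ^ 2 ≤ l p * l (a ^ 2 * p) := by
  have h : ∀ x : ℝ, 0 ≤ l (a ^ 2 * p) * (x * x) + (2 * l (a * p)) * x + l p := by
    intro x
    have h1 := hl _ (hsq (x • a + 1) p hp)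
    have h2 : (x • a + 1) ^ 2 * p = (x * x) • (a ^ 2 * p) + (2 * x) • (a * p) + p := by
      simp only [Algebra.smul_def, map_mul, map_ofNat]
      ring
    rw [h2] at h1
    simp only [map_add, map_smul, smul_eq_mul] at h1
    linarith
  have := discrim_le_zero h
  rw [discrim] at this
  nlinarith

/-- If `q² ≤ 1` modulo `M`, then a functional that is nonnegative on `M` satisfies
`l (q² p) ≤ l p` for `p ∈ M`, although `(1 - q²) p` need not lie in `M`: by Cauchy–Schwarz
the numbers `l (q ^ (2 m) p)` grow at least geometrically with ratio `l (q² p) / l p`, while they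
are bounded by a multiple of `l (q ^ (2 m)) ≤ l 1`. -/
theorem state_sq_mul_le (hone : (1 : A) ∈ M) (hsq : ∀ a, ∀ p ∈ M, a ^ 2 * p ∈ M)
    (harch : ∀ a : A, ∃ c : ℝ, c • 1 - a ∈ M) {l : A →ₗ[ℝ] ℝ} (hl : ∀ p ∈ M, 0 ≤ l p)
    {q : A} (hq : 1 - q ^ 2 ∈ M) {p : A} (hp : p ∈ M) : l (q ^ 2 * p) ≤ l p := by
  obtain ⟨c, hc⟩ := harch p
  have hbound : ∀ m : ℕ, l (q ^ (2 * m)) ≤ l 1 := by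
    intro m
    induction m with
    | zero => simp
    | succ m ih =>
      have := hl _ (hsq (q ^ m) _ hq)
      have h2 : (q ^ m) ^ 2 * (1 - q ^ 2) = q ^ (2 * m) - q ^ (2 * (m + 1)) := by ring
      rw [h2, map_sub] at this
      linarith
  have hsqm : ∀ m : ℕ, 0 ≤ l (q ^ (2 * m)) := by
    intro m
    have := hl _ (hsq (q ^ m) _ hone)
    rwa [mul_one, ← pow_mul, mul_comm m 2] at this
  have hupper : ∀ m : ℕ, l (q ^ (2 * m) * p) ≤ |c| * l 1 := by
    intro m
    have := hl _ (hsq (q ^ m) _ hc)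
    have h2 : (q ^ m) ^ 2 * (c • 1 - p) = c • q ^ (2 * m) - q ^ (2 * m) * p := by
      simp only [Algebra.smul_def]; ring
    rw [h2, map_sub, map_smul, smul_eq_mul] at this
    calc l (q ^ (2 * m) * p) ≤ c * l (q ^ (2 * m)) := by linarith
      _ ≤ |c| * l (q ^ (2 * m)) := mul_le_mul_of_nonneg_right (le_abs_self c) (hsqm m)
      _ ≤ |c| * l 1 := mul_le_mul_of_nonneg_left (hbound m) (abs_nonneg c)
  have ha0 := hl p hp
  have ha1 := hl _ (hsq q p hp)
  have hlower : ∀ k : ℕ, l (q ^ 2 * p) ^ 2 ^ k ≤ l p ^ (2 ^ k - 1) * l (q ^ (2 * 2 ^ k) * p) := by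
    intro k
    induction k with
    | zero => simp
    | succ k ih =>
      have h1 := sq_mul_state_le hsq hl hp (q ^ (2 * 2 ^ k))
      rw [← pow_mul, show 2 * 2 ^ k * 2 = 2 * 2 ^ (k + 1) by ring] at h1
      have h3 : 2 ^ (k + 1) - 1 = (2 ^ k - 1) * 2 + 1 := by
        have := Nat.one_le_two_pow (n := k)
        rw [pow_succ]; omega
      calc l (q ^ 2 * p) ^ 2 ^ (k + 1) = (l (q ^ 2 * p) ^ 2 ^ k) ^ 2 := by
            rw [← pow_mul, pow_succ 2 k]
        _ ≤ (l p ^ (2 ^ k - 1) * l (q ^ (2 * 2 ^ k) * p)) ^ 2 :=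
            pow_le_pow_left₀ (pow_nonneg ha1 _) ih 2
        _ = l p ^ ((2 ^ k - 1) * 2) * l (q ^ (2 * 2 ^ k) * p) ^ 2 := by rw [mul_pow, ← pow_mul]
        _ ≤ l p ^ ((2 ^ k - 1) * 2) * (l p * l (q ^ (2 * 2 ^ (k + 1)) * p)) :=
            mul_le_mul_of_nonneg_left h1 (pow_nonneg ha0 _)
        _ = _ := by rw [h3, pow_succ (l p), mul_assoc]
  by_contra! hlt
  rcases ha0.eq_or_lt with h0 | h0
  · have := sq_mul_state_le hsq hl hp (q ^ 2)
    rw [← h0, zero_mul] at this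
    nlinarith
  · -- the ratio exceeds `1`, so its powers are unbounded
    have hr : 1 < l (q ^ 2 * p) / l p := (one_lt_div h0).2 hlt
    obtain ⟨k, hk⟩ := pow_unbounded_of_one_lt (|c| * l 1 / l p) hr
    have h1 : (l (q ^ 2 * p) / l p) ^ 2 ^ k ≤ |c| * l 1 / l p := by
      rw [div_pow, div_le_div_iff₀ (pow_pos h0 _) h0]
      have h3 : l p ^ 2 ^ k = l p ^ (2 ^ k - 1) * l p := by
        rw [← pow_succ, Nat.sub_add_cancel Nat.one_le_two_pow]
      rw [h3]
      calc _ ≤ (l p ^ (2 ^ k - 1) * l (q ^ (2 * 2 ^ k) * p)) * l p :=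
            mul_le_mul_of_nonneg_right (hlower k) ha0
        _ ≤ (l p ^ (2 ^ k - 1) * (|c| * l 1)) * l p :=
            mul_le_mul_of_nonneg_right
              (mul_le_mul_of_nonneg_left (hupper _) (pow_nonneg ha0 _)) ha0
        _ = _ := by ring
    have h2 : (l (q ^ 2 * p) / l p) ^ k ≤ (l (q ^ 2 * p) / l p) ^ 2 ^ k :=
      pow_le_pow_right₀ hr.le Nat.lt_two_pow_self.le
    linarith

/-- An extreme state `l` is the convex combination of the states proportional to `p ↦ l (q² p)` and
`p ↦ l ((1 - q²) p)`, hence proportional to both. The bound `1 / 2` keeps `l (1 - q²)` away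
from `0`. -/
theorem extreme_state_sq_mul_of_le (hone : (1 : A) ∈ M) (hsq : ∀ a, ∀ p ∈ M, a ^ 2 * p ∈ M)
    (harch : ∀ a : A, ∃ c : ℝ, c • 1 - a ∈ M) {l : A →ₗ[ℝ] ℝ}
    (hl : ⇑l ∈ (states M).extremePoints ℝ) {q : A} (hq : (1 / 2 : ℝ) • 1 - q ^ 2 ∈ M) (p : A) :
    l (q ^ 2 * p) = l (q ^ 2) * l p := by
  obtain ⟨⟨l', hl', h1, hpos⟩, hext⟩ := hl
  obtain rfl : l' = l := DFunLike.coe_injective hl'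
  have hq1 : 1 - q ^ 2 ∈ M := by
    have h2 := M.add_mem hq (M.smul_mem (show (0 : ℝ) ≤ 1 / 2 by norm_num) hone)
    rwa [sub_add_eq_add_sub, ← add_smul, add_halves, one_smul] at h2
  have hθ : l' (q ^ 2) ≤ 1 / 2 := by
    have := hpos _ hq
    rw [map_sub, map_smul, h1] at this
    simpa using this
  have hθ0 : 0 ≤ l' (q ^ 2) := by simpa using hpos _ (hsq q 1 hone)
  rcases hθ0.eq_or_lt with h0 | h0
  · have hle : ∀ p, l' (q ^ 2 * p) ≤ 0 := by
      intro p
      obtain ⟨c, hc⟩ := harch p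
      have := hpos _ (hsq q _ hc)
      rw [mul_sub, mul_smul_comm, mul_one, map_sub, map_smul, ← h0, smul_zero] at this
      linarith
    have h2 := hle (-p)
    rw [mul_neg, map_neg] at h2
    rw [← h0, zero_mul]
    exact le_antisymm (hle p) (by linarith)
  · let m : A →ₗ[ℝ] ℝ := l' ∘ₗ LinearMap.mulLeft ℝ (q ^ 2)
    have hm : ∀ p, m p = l' (q ^ 2 * p) := fun p => rfl
    have hθ1 : 0 < 1 - l' (q ^ 2) := by linarith
    have hA : ⇑((l' (q ^ 2))⁻¹ • m) ∈ states M :=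
      ⟨_, rfl, by simp [hm, h0.ne'], fun p hp => by
        simpa [hm] using mul_nonneg (inv_nonneg.2 h0.le) (hpos _ (hsq q p hp))⟩
    have hB : ⇑((1 - l' (q ^ 2))⁻¹ • (l' - m)) ∈ states M :=
      ⟨_, rfl, by simp [hm, h1, hθ1.ne'], fun p hp => by
        have := state_sq_mul_le hone hsq harch hpos hq1 hp
        simpa [hm] using mul_nonneg (inv_nonneg.2 hθ1.le) (sub_nonneg.2 this)⟩
    have := hext hA hB ⟨l' (q ^ 2), 1 - l' (q ^ 2), h0, hθ1, by ring, by
      ext p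
      simp only [Pi.add_apply, Pi.smul_apply, LinearMap.smul_apply, LinearMap.sub_apply,
        smul_eq_mul]
      field_simp
      ring⟩
    have h3 := congrFun this p
    simp only [LinearMap.smul_apply, hm, smul_eq_mul] at h3
    field_simp at h3
    exact h3

/-- Extreme states are multiplicative. Rescaling reduces `l (q² p) = l (q²) l p` to small `q`, and
the general product follows by replacing `q` with `q + 1`. -/
theorem extreme_state_mul (hone : (1 : A) ∈ M) (hsq : ∀ a, ∀ p ∈ M, a ^ 2 * p ∈ M)
    (harch : ∀ a : A, ∃ c : ℝ, c • 1 - a ∈ M) {l : A →ₗ[ℝ] ℝ}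
    (hl : ⇑l ∈ (states M).extremePoints ℝ) (q p : A) :
    l (q * p) = l q * l p := by
  have hsquare : ∀ q : A, l (q ^ 2 * p) = l (q ^ 2) * l p := by
    intro q
    obtain ⟨c, hc⟩ := harch (q ^ 2)
    -- rescale `q` so that its square is at most `1 / 2`
    have hc' : 0 < 2 * (|c| + 1) := by positivity
    have hr : 0 < Real.sqrt (2 * (|c| + 1))⁻¹ := Real.sqrt_pos.2 (inv_pos.2 hc')
    set r := Real.sqrt (2 * (|c| + 1))⁻¹ with hrdef
    have hr2 : r ^ 2 = (2 * (|c| + 1))⁻¹ := Real.sq_sqrt (inv_pos.2 hc').le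
    have key := extreme_state_sq_mul_of_le hone hsq harch hl (q := r • q) (by
      have h2 := M.smul_mem (sq_nonneg r) hc
      have h3 : 0 ≤ 1 / 2 - r ^ 2 * c := by
        rw [hr2]
        field_simp
        linarith [le_abs_self c]
      have h4 := M.add_mem h2 (M.smul_mem h3 hone)
      convert h4 using 1
      rw [smul_pow, smul_sub, smul_smul, sub_smul]
      abel) p
    rw [smul_pow, smul_mul_assoc, map_smul, map_smul, smul_eq_mul, smul_eq_mul, mul_assoc] at key
    exact mul_left_cancel₀ (pow_pos hr 2).ne' key
  have h1 := hsquare (q + 1)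
  have h2 := hsquare q
  have h3 : (q + 1) ^ 2 * p = q ^ 2 * p + (2 : ℝ) • (q * p) + p := by
    rw [Algebra.smul_def, map_ofNat]; ring
  have h4 : (q + 1) ^ 2 = q ^ 2 + (2 : ℝ) • q + 1 := by
    rw [Algebra.smul_def, map_ofNat]; ring
  obtain ⟨⟨l', hl', hl1, -⟩, -⟩ := hl
  obtain rfl : l' = l := DFunLike.coe_injective hl'
  rw [h3, h4] at h1
  simp only [map_add, map_smul, smul_eq_mul, hl1] at h1
  linarith

/-- **Representation theorem for archimedean quadratic modules.** An element outside of the module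
is nonpositive at some real point at which the whole module is nonnegative. -/
theorem exists_algHom_nonpos_of_notMem (hone : (1 : A) ∈ M) (hsq : ∀ a, ∀ p ∈ M, a ^ 2 * p ∈ M)
    (harch : ∀ a : A, ∃ c : ℝ, c • 1 - a ∈ M) {f : A} (hf : f ∉ M) :
    ∃ φ : A →ₐ[ℝ] ℝ, (∀ p ∈ M, 0 ≤ φ p) ∧ φ f ≤ 0 := by
  -- a state that is nonpositive at `f`, from the cone generated by `M` and `-f`
  obtain ⟨L, hL1, hL⟩ := exists_positive_functional (M ⊔ PointedCone.hull ℝ {-f}) (1 : A)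
    (fun v => by
      obtain ⟨c, hc⟩ := harch (-v)
      exact ⟨c, Submodule.mem_sup_left (by simpa using hc)⟩)
    (fun h => by
      obtain ⟨q, hq, r, hr, hqr⟩ := Submodule.mem_sup.1 h
      obtain ⟨⟨c, hc⟩, rfl⟩ := Submodule.mem_span_singleton.1 hr
      have h1 : q + c • (-f) = -1 := hqr
      rcases hc.eq_or_lt with rfl | hc
      · -- `-1 ∈ M` makes every element a member
        have hq' : (-1 : A) ∈ M := by
          rw [← h1]; simpa using hq
        refine hf ?_
        have h2 := M.add_mem (hsq ((1 / 2 : ℝ) • (f + 1)) 1 hone)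
          (hsq ((1 / 2 : ℝ) • (f - 1)) _ hq')
        convert h2 using 1
        have h4 : (algebraMap ℝ A) (1 / 2) * 2 = 1 := by
          rw [← map_ofNat (algebraMap ℝ A) 2, ← map_mul]; norm_num
        simp only [Algebra.smul_def]
        linear_combination (-f * ((algebraMap ℝ A) (1 / 2) * 2 + 1)) * h4
      · refine hf ?_
        have h3 := M.smul_mem (inv_nonneg.2 hc.le) (M.add_mem hq hone)
        have h4 : q + 1 = c • f := by
          rw [smul_neg] at h1
          linear_combination h1
        rwa [h4, smul_smul, inv_mul_cancel₀ hc.ne', one_smul] at h3)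
  have hLM : ⇑L ∈ states M := ⟨L, rfl, hL1, fun p hp => hL p (Submodule.mem_sup_left hp)⟩
  have hLf : L f ≤ 0 := by
    have := hL _ (Submodule.mem_sup_right (Submodule.mem_span_singleton_self (-f)))
    rw [map_neg] at this
    linarith
  -- an extreme point of the face of states that are minimal at `f`
  have hcomp := isCompact_states harch
  obtain ⟨L₀, hL₀, hmin⟩ := hcomp.exists_isMinOn ⟨_, hLM⟩ (continuous_apply f).continuousOn
  let ev : (A → ℝ) →L[ℝ] ℝ := -ContinuousLinearMap.proj (R := ℝ) (φ := fun _ : A => ℝ) f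
  have hexp : IsExposed ℝ (states M) {x ∈ states M | ∀ y ∈ states M, ev y ≤ ev x} :=
    fun _ => ⟨ev, rfl⟩
  obtain ⟨K, hK⟩ := (hexp.isCompact hcomp).extremePoints_nonempty
    ⟨L₀, hL₀, fun y hy => by simpa [ev] using hmin hy⟩
  have hKf := hK.1.2 _ hLM
  have hKext := hexp.isExtreme.extremePoints_subset_extremePoints hK
  obtain ⟨l, rfl, hl1, hlpos⟩ := hK.1.1
  refine ⟨AlgHom.ofLinearMap l hl1 fun q p => extreme_state_mul hone hsq harch hKext q p,
    hlpos, ?_⟩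
  simp only [ev, neg_apply, ContinuousLinearMap.proj_apply] at hKf
  have : l f ≤ 0 := by linarith
  exact this

end States

/-! ### Putinar's Positivstellensatz -/

section Bounded

variable {A : Type*} [CommRing A] [Algebra ℝ A] {M : PointedCone ℝ A}

theorem smul_one_sub_mem_of_le (hone : (1 : A) ∈ M) {a : A} {c c' : ℝ} (h : c • 1 - a ∈ M)
    (hc : c ≤ c') : c' • 1 - a ∈ M := by
  have := M.add_mem h (M.smul_mem (sub_nonneg.2 hc) hone)
  rwa [sub_smul, add_comm, ← add_sub_assoc, sub_add_cancel] at this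

theorem exists_smul_one_sub_sq_mem (hone : (1 : A) ∈ M) (hsq : ∀ a, ∀ p ∈ M, a ^ 2 * p ∈ M)
    {a : A} {c : ℝ} (h₁ : c • 1 - a ∈ M) (h₂ : c • 1 - -a ∈ M) :
    ∃ c' : ℝ, c' • 1 - a ^ 2 ∈ M := by
  have hle : c ≤ |c| + 1 := by linarith [le_abs_self c]
  have hpos : 0 < |c| + 1 := by positivity
  replace h₁ := smul_one_sub_mem_of_le hone h₁ hle
  replace h₂ := smul_one_sub_mem_of_le hone h₂ hle
  generalize |c| + 1 = r at *
  refine ⟨r ^ 2, ?_⟩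
  have h := M.smul_mem (show 0 ≤ (2 * r)⁻¹ by positivity)
    (M.add_mem (hsq (r • 1 + a) _ h₁) (hsq (r • 1 - a) _ h₂))
  -- `(r + a)² (r - a) + (r - a)² (r + a) = 2 r (r² - a²)`
  have e : (r • 1 + a) ^ 2 * (r • 1 - a) + (r • 1 - a) ^ 2 * (r • 1 - -a) =
      (2 * r) • (r ^ 2 • 1 - a ^ 2) := by
    simp only [Algebra.smul_def, map_mul, map_pow, map_ofNat]
    ring
  rwa [e, smul_smul, inv_mul_cancel₀ (by positivity), one_smul] at h

/-- The elements that are bounded above and below by constants modulo a quadratic module form a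
subalgebra. -/
def boundedSubalgebra (hone : (1 : A) ∈ M) (hsq : ∀ a, ∀ p ∈ M, a ^ 2 * p ∈ M) :
    Subalgebra ℝ A where
  carrier := {a | ∃ c : ℝ, c • 1 - a ∈ M ∧ c • 1 - -a ∈ M}
  algebraMap_mem' r := by
    refine ⟨|r|, ?_, ?_⟩
    · rw [Algebra.algebraMap_eq_smul_one, ← sub_smul]
      exact M.smul_mem (by linarith [le_abs_self r]) hone
    · rw [Algebra.algebraMap_eq_smul_one, ← neg_smul, ← sub_smul]
      exact M.smul_mem (by linarith [neg_abs_le r]) hone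
  add_mem' := by
    rintro a b ⟨c, h₁, h₂⟩ ⟨c', h₃, h₄⟩
    refine ⟨c + c', ?_, ?_⟩
    · have := M.add_mem h₁ h₃
      rwa [sub_add_sub_comm, ← add_smul] at this
    · have := M.add_mem h₂ h₄
      rwa [sub_add_sub_comm, ← add_smul, ← neg_add] at this
  mul_mem' := by
    have key : ∀ {a b : A} {c c' : ℝ}, c • 1 - a ∈ M → c • 1 - -a ∈ M → c' • 1 - b ∈ M →
        c' • 1 - -b ∈ M → ∃ r : ℝ, r • 1 - a * b ∈ M := by
      intro a b c c' h₁ h₂ h₃ h₄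
      obtain ⟨r, hr⟩ := exists_smul_one_sub_sq_mem hone hsq (a := a + b) (c := c + c')
        (by simpa only [sub_add_sub_comm, ← add_smul] using M.add_mem h₁ h₃)
        (by simpa only [sub_add_sub_comm, ← add_smul, ← neg_add] using M.add_mem h₂ h₄)
      refine ⟨2⁻¹ * r, ?_⟩
      have h := M.smul_mem (show (0 : ℝ) ≤ 2⁻¹ by norm_num)
        (M.add_mem (M.add_mem hr (hsq a 1 hone)) (hsq b 1 hone))
      have e : r • 1 - (a + b) ^ 2 + a ^ 2 * 1 + b ^ 2 * 1 = r • 1 - (2 : ℝ) • (a * b) := by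
        simp only [Algebra.smul_def, map_ofNat]
        ring
      rwa [e, smul_sub, smul_smul, smul_smul, inv_mul_cancel₀ two_ne_zero, one_smul] at h
    rintro a b ⟨c, h₁, h₂⟩ ⟨c', h₃, h₄⟩
    obtain ⟨r, hr⟩ := key h₁ h₂ h₃ h₄
    obtain ⟨r', hr'⟩ := key h₂ (by rwa [neg_neg]) h₃ h₄
    rw [neg_mul] at hr'
    exact ⟨max r r', smul_one_sub_mem_of_le hone hr (le_max_left _ _),
      smul_one_sub_mem_of_le hone hr' (le_max_right _ _)⟩

theorem mem_boundedSubalgebra_of_sq (hone : (1 : A) ∈ M) (hsq : ∀ a, ∀ p ∈ M, a ^ 2 * p ∈ M)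
    {a : A} {c : ℝ} (h : c • 1 - a ^ 2 ∈ M) : a ∈ boundedSubalgebra hone hsq := by
  have key : ∀ b : A, b ^ 2 = a ^ 2 → (c + (1 / 2) ^ 2) • 1 - b ∈ M := by
    intro b hb
    rw [← hb] at h
    have h' := M.add_mem h (hsq ((1 / 2 : ℝ) • 1 - b) 1 hone)
    have h2 : (algebraMap ℝ A) (1 / 2) * 2 = 1 := by
      rw [← map_ofNat (algebraMap ℝ A) 2, ← map_mul]; norm_num
    have e : c • 1 - b ^ 2 + ((1 / 2 : ℝ) • 1 - b) ^ 2 * 1 = (c + (1 / 2) ^ 2) • 1 - b := by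
      simp only [Algebra.smul_def, map_add, map_pow]
      linear_combination (-b) * h2
    rwa [e] at h'
  exact ⟨_, key a rfl, key (-a) (neg_sq a)⟩

end Bounded

section Putinar

open MvPolynomial

variable {d H : ℕ}

theorem eval_isSumSq_nonneg {s : MvPolynomial (Fin d) ℝ} (hs : IsSumSq s) (x : Fin d → ℝ) :
    0 ≤ eval x s := by
  induction hs with
  | zero => simp
  | sq_add a _ ih =>
    rw [map_add, map_mul]
    exact add_nonneg (mul_self_nonneg _) ih

theorem isSumSq_C {c : ℝ} (hc : 0 ≤ c) : IsSumSq (C c : MvPolynomial (Fin d) ℝ) := by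
  rw [← Real.mul_self_sqrt hc, C_mul]
  exact IsSumSq.mul_self _

theorem isSumSq_mul_mem_quadraticModule {g : Fin H → MvPolynomial (Fin d) ℝ}
    {s p : MvPolynomial (Fin d) ℝ} (hs : IsSumSq s) (hp : p ∈ quadraticModule g) :
    s * p ∈ quadraticModule g := by
  obtain ⟨σ₀, σ, h₀, h, rfl⟩ := hp
  refine ⟨s * σ₀, fun i => s * σ i, hs.mul h₀, fun i => hs.mul (h i), ?_⟩
  simp only [mul_add, Finset.mul_sum, mul_assoc]

/-- The quadratic module `Q(g)`, bundled as a convex cone. -/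
def quadraticCone (g : Fin H → MvPolynomial (Fin d) ℝ) :
    PointedCone ℝ (MvPolynomial (Fin d) ℝ) where
  carrier := quadraticModule g
  zero_mem' := ⟨0, fun _ => 0, .zero, fun _ => .zero, by simp⟩
  add_mem' := by
    rintro _ _ ⟨σ₀, σ, h₀, h, rfl⟩ ⟨τ₀, τ, k₀, k, rfl⟩
    refine ⟨σ₀ + τ₀, fun i => σ i + τ i, h₀.add k₀, fun i => (h i).add (k i), ?_⟩
    simp only [add_mul, Finset.sum_add_distrib]
    ring
  smul_mem' := by
    rintro ⟨c, hc⟩ p hp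
    have := isSumSq_mul_mem_quadraticModule (isSumSq_C hc) hp
    rwa [← smul_eq_C_mul] at this

theorem isSumSq_mem_quadraticModule (g : Fin H → MvPolynomial (Fin d) ℝ)
    {s : MvPolynomial (Fin d) ℝ} (hs : IsSumSq s) : s ∈ quadraticModule g :=
  ⟨s, fun _ => 0, hs, fun _ => .zero, by simp⟩

theorem generator_mem_quadraticModule (g : Fin H → MvPolynomial (Fin d) ℝ) (h : Fin H) :
    g h ∈ quadraticModule g := by
  refine ⟨0, Pi.single h 1, .zero, fun i => ?_, ?_⟩
  · by_cases hi : i = h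
    · subst hi
      simp
    · rw [Pi.single_eq_of_ne hi]
      exact .zero
  · simp [Pi.single_apply]

theorem exists_smul_one_sub_mem_quadraticModule {g : Fin H → MvPolynomial (Fin d) ℝ}
    (harch : IsArchimedean g) (a : MvPolynomial (Fin d) ℝ) :
    ∃ c : ℝ, c • 1 - a ∈ quadraticCone g := by
  have hone : (1 : MvPolynomial (Fin d) ℝ) ∈ quadraticCone g :=
    isSumSq_mem_quadraticModule g IsSumSq.one
  have hsq : ∀ a, ∀ p ∈ quadraticCone g, a ^ 2 * p ∈ quadraticCone g := fun a p hp =>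
    isSumSq_mul_mem_quadraticModule (by rw [sq]; exact IsSumSq.mul_self a) hp
  obtain ⟨r, -, hr⟩ := harch
  have hX : Set.range X ⊆ (boundedSubalgebra hone hsq : Set (MvPolynomial (Fin d) ℝ)) := by
    rintro _ ⟨i, rfl⟩
    refine mem_boundedSubalgebra_of_sq hone hsq (c := r) ?_
    have h1 : ∑ j ∈ Finset.univ.erase i, (X j : MvPolynomial (Fin d) ℝ) ^ 2 ∈ quadraticCone g :=
      isSumSq_mem_quadraticModule g (IsSumSq.sum_sq _ _)
    have h2 := (quadraticCone g).add_mem hr h1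
    rw [← Finset.add_sum_erase _ _ (Finset.mem_univ i)] at h2
    rw [smul_eq_C_mul, mul_one]
    convert h2 using 1
    ring
  have htop := Algebra.adjoin_le_iff.2 hX
  rw [adjoin_range_X] at htop
  obtain ⟨c, hc, -⟩ := htop (Algebra.mem_top (x := a))
  exact ⟨c, hc⟩

/-- **Putinar's Positivstellensatz.** -/
theorem mem_quadraticModule_of_pos {g : Fin H → MvPolynomial (Fin d) ℝ}
    (harch : IsArchimedean g) {f : MvPolynomial (Fin d) ℝ}
    (hf : ∀ x ∈ semialgebraicSet g, 0 < eval x f) : f ∈ quadraticModule g := by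
  by_contra hfQ
  obtain ⟨φ, hφ, hφf⟩ := exists_algHom_nonpos_of_notMem (M := quadraticCone g)
    (isSumSq_mem_quadraticModule g IsSumSq.one)
    (fun a p hp => isSumSq_mul_mem_quadraticModule (by rw [sq]; exact IsSumSq.mul_self a) hp)
    (exists_smul_one_sub_mem_quadraticModule harch) hfQ
  have heval : ∀ p, φ p = eval (fun i => φ (X i)) p := by
    intro p
    rw [← coe_aeval_eq_eval, RingHom.coe_coe]
    exact congrArg (fun ψ : MvPolynomial (Fin d) ℝ →ₐ[ℝ] ℝ => ψ p)
      (algHom_ext (by simp) : φ = aeval fun i => φ (X i))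
  have hx : (fun i => φ (X i)) ∈ semialgebraicSet g := fun h => by
    rw [← heval]
    exact hφ _ (generator_mem_quadraticModule g h)
  have := hf _ hx
  rw [← heval] at this
  exact absurd this hφf.not_gt

end Putinar

/-! ### Best approximation and its dual -/

open MvPolynomial

variable {d H : ℕ}

section Approximation

variable {Ω : Set (Fin d → ℝ)}

theorem abs_eval_le_uniformNorm (hΩ : IsCompact Ω) (q : MvPolynomial (Fin d) ℝ) {x : Fin d → ℝ}
    (hx : x ∈ Ω) : |eval x q| ≤ uniformNorm Ω q :=
  le_csSup (hΩ.image q.continuous_eval.abs).bddAbove ⟨x, hx, rfl⟩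

theorem uniformNorm_le (hne : Ω.Nonempty) {q : MvPolynomial (Fin d) ℝ} {c : ℝ}
    (h : ∀ x ∈ Ω, |eval x q| ≤ c) : uniformNorm Ω q ≤ c :=
  csSup_le (hne.image _) (Set.forall_mem_image.2 h)

theorem bestApproxError_le {m : ℕ} (f : MvPolynomial (Fin d) ℝ) {p : MvPolynomial (Fin d) ℝ}
    (hp : p ∈ restrictTotalDegree (Fin d) ℝ m) :
    bestApproxError m f Ω ≤ uniformNorm Ω (f - p) :=
  csInf_le ⟨0, Set.forall_mem_image.2 fun _ _ =>
    Real.sSup_nonneg (Set.forall_mem_image.2 fun _ _ => abs_nonneg _)⟩ ⟨p, hp, rfl⟩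

theorem bestApproxError_le_of_abs_le (hne : Ω.Nonempty) {m : ℕ} {f p : MvPolynomial (Fin d) ℝ}
    (hp : p ∈ restrictTotalDegree (Fin d) ℝ m) {c : ℝ}
    (h : ∀ x ∈ Ω, |eval x f - eval x p| ≤ c) : bestApproxError m f Ω ≤ c :=
  (bestApproxError_le f hp).trans (uniformNorm_le hne (by simpa using h))

theorem exists_uniformNorm_lt {m : ℕ} {f : MvPolynomial (Fin d) ℝ} {c : ℝ}
    (hc : bestApproxError m f Ω < c) :
    ∃ p ∈ restrictTotalDegree (Fin d) ℝ m, uniformNorm Ω (f - p) < c := by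
  obtain ⟨_, ⟨p, hp, rfl⟩, h⟩ := exists_lt_of_csInf_lt (Set.Nonempty.image _ ⟨0, Submodule.zero_mem _⟩) hc
  exact ⟨p, hp, h⟩

/-- The dual side of best approximation: a pair of positive functionals on polynomials, of total
mass `1`, whose difference annihilates the approximating space and is at least the
approximation error at `f`. They play the part of the positive and the negative part of an extremal
signed measure. -/
theorem exists_extremal_functionals (hΩ : IsCompact Ω) (hne : Ω.Nonempty) (m : ℕ)
    (f : MvPolynomial (Fin d) ℝ) :
    ∃ Lp Lm : MvPolynomial (Fin d) ℝ →ₗ[ℝ] ℝ,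
      (∀ q, (∀ x ∈ Ω, 0 ≤ eval x q) → 0 ≤ Lp q) ∧ (∀ q, (∀ x ∈ Ω, 0 ≤ eval x q) → 0 ≤ Lm q) ∧
      Lp 1 + Lm 1 = 1 ∧ (∀ p ∈ restrictTotalDegree (Fin d) ℝ m, Lp p = Lm p) ∧
      bestApproxError m f Ω ≤ Lp f - Lm f := by
  set E := bestApproxError m f Ω with hE
  -- nonnegative pairs, enlarged by the pairs `(p, -p)` and by `(f - E, -f - E)`
  let s : PointedCone ℝ (MvPolynomial (Fin d) ℝ × MvPolynomial (Fin d) ℝ) :=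
    { carrier := {v | ∃ p ∈ restrictTotalDegree (Fin d) ℝ m, ∃ r : ℝ, 0 ≤ r ∧
        (∀ x ∈ Ω, 0 ≤ eval x v.1 - eval x p - r * (eval x f - E)) ∧
        ∀ x ∈ Ω, 0 ≤ eval x v.2 + eval x p + r * (eval x f + E)}
      zero_mem' := ⟨0, Submodule.zero_mem _, 0, le_rfl, by simp, by simp⟩
      add_mem' := by
        rintro v w ⟨p, hp, r, hr, h₁, h₂⟩ ⟨p', hp', r', hr', h₁', h₂'⟩
        refine ⟨p + p', Submodule.add_mem _ hp hp', r + r', add_nonneg hr hr',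
          fun x hx => ?_, fun x hx => ?_⟩
        · rw [Prod.fst_add, map_add, map_add]
          linarith [h₁ x hx, h₁' x hx]
        · rw [Prod.snd_add, map_add, map_add]
          linarith [h₂ x hx, h₂' x hx]
      smul_mem' := by
        rintro ⟨c, hc⟩ v ⟨p, hp, r, hr, h₁, h₂⟩
        refine ⟨c • p, Submodule.smul_mem _ _ hp, c * r, mul_nonneg hc hr,
          fun x hx => ?_, fun x hx => ?_⟩
        · change 0 ≤ eval x (c • v.1) - _ - _
          rw [smul_eval, smul_eval]
          nlinarith [mul_nonneg hc (h₁ x hx)]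
        · change 0 ≤ eval x (c • v.2) + _ + _
          rw [smul_eval, smul_eval]
          nlinarith [mul_nonneg hc (h₂ x hx)] }
  have hs : ∀ {u v p : MvPolynomial (Fin d) ℝ} {r : ℝ}, p ∈ restrictTotalDegree (Fin d) ℝ m →
      0 ≤ r → (∀ x ∈ Ω, 0 ≤ eval x u - eval x p - r * (eval x f - E)) →
      (∀ x ∈ Ω, 0 ≤ eval x v + eval x p + r * (eval x f + E)) → (u, v) ∈ s :=
    fun hp hr h₁ h₂ => ⟨_, hp, _, hr, h₁, h₂⟩
  have hs0 : ∀ {u v : MvPolynomial (Fin d) ℝ}, (∀ x ∈ Ω, 0 ≤ eval x u) →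
      (∀ x ∈ Ω, 0 ≤ eval x v) → (u, v) ∈ s := fun hu hv =>
    hs (Submodule.zero_mem _) le_rfl (by simpa using hu) (by simpa using hv)
  obtain ⟨L, hL1, hL⟩ := exists_positive_functional s (1, 1)
    (by
      rintro ⟨u, v⟩
      refine ⟨uniformNorm Ω u + uniformNorm Ω v, ?_⟩
      have hpos : ∀ q, 0 ≤ uniformNorm Ω q := fun q =>
        Real.sSup_nonneg (Set.forall_mem_image.2 fun _ _ => abs_nonneg _)
      refine hs0 (fun x hx => ?_) (fun x hx => ?_)
      · have := neg_le_of_abs_le (abs_eval_le_uniformNorm hΩ u hx)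
        change 0 ≤ eval x (_ • (1 : MvPolynomial (Fin d) ℝ) + u)
        rw [map_add, smul_eval, map_one]
        linarith [hpos v]
      · have := neg_le_of_abs_le (abs_eval_le_uniformNorm hΩ v hx)
        change 0 ≤ eval x (_ • (1 : MvPolynomial (Fin d) ℝ) + v)
        rw [map_add, smul_eval, map_one]
        linarith [hpos u])
    (by
      rintro ⟨p, hp, r, hr, h₁, h₂⟩
      simp only [Prod.fst_neg, Prod.snd_neg, map_neg, map_one] at h₁ h₂
      rcases hr.eq_or_lt with rfl | hr
      · obtain ⟨x, hx⟩ := hne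
        linarith [h₁ x hx, h₂ x hx]
      · -- `-p / r` would approximate `f` with error at most `E - 1 / r`
        have : E ≤ E - r⁻¹ := bestApproxError_le_of_abs_le hne
          (Submodule.smul_mem _ (-r⁻¹) hp) (fun x hx => by
            rw [smul_eval, abs_le]
            constructor
            · have := mul_nonneg (inv_nonneg.2 hr.le) (h₂ x hx)
              field_simp at this ⊢
              linarith
            · have := mul_nonneg (inv_nonneg.2 hr.le) (h₁ x hx)
              field_simp at this ⊢
              linarith)
        linarith [inv_pos.2 hr])
  have hsplit : ∀ u v, L (u, v) = L (u, 0) + L (0, v) := fun u v => by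
    rw [← map_add, Prod.mk_add_mk, add_zero, zero_add]
  have hneg : ∀ u, L (0, -u) = -L (0, u) := fun u => by
    rw [← map_neg, Prod.neg_mk, neg_zero]
  refine ⟨L ∘ₗ LinearMap.inl ℝ _ _, L ∘ₗ LinearMap.inr ℝ _ _, ?_, ?_, ?_, ?_, ?_⟩ <;>
    simp only [LinearMap.comp_apply, LinearMap.inl_apply, LinearMap.inr_apply]
  · exact fun q hq => hL _ (hs0 hq (by simp))
  · exact fun q hq => hL _ (hs0 (by simp) hq)
  · rw [← hsplit, hL1]
  · have key : ∀ p ∈ restrictTotalDegree (Fin d) ℝ m, 0 ≤ L (p, 0) - L (0, p) := by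
      intro p hp
      have := hL _ (hs (u := p) (v := -p) hp le_rfl (by simp) (by simp))
      rw [hsplit, hneg] at this
      linarith
    intro p hp
    have h₁ := key p hp
    have h₂ := key (-p) (Submodule.neg_mem _ hp)
    have h₃ : L (-p, 0) = -L (p, 0) := by rw [← map_neg, Prod.neg_mk, neg_zero]
    rw [hneg, h₃] at h₂
    linarith
  · have := hL ((f, -f) - E • (1, 1)) (hs (p := 0) (r := 1) (Submodule.zero_mem _) zero_le_one
      (fun x _ => by change 0 ≤ eval x (f - E • 1) - _ - _; simp)
      (fun x _ => by change 0 ≤ eval x (-f - E • 1) + _ + _; simp))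
    rw [map_sub, map_smul, hL1, hsplit, hneg, smul_eq_mul] at this
    linarith

end Approximation

/-! ### The sum-of-squares program -/

section SumOfSquaresBound

theorem eval_nonneg_of_mem_truncatedQuadraticModule {g : Fin H → MvPolynomial (Fin d) ℝ} {t : ℕ}
    {p : MvPolynomial (Fin d) ℝ} (hp : p ∈ truncatedQuadraticModule g t) {x : Fin d → ℝ}
    (hx : x ∈ semialgebraicSet g) : 0 ≤ eval x p := by
  obtain ⟨σ₀, σ, h₀, h, -, -, rfl⟩ := hp
  simp only [map_add, map_sum, map_mul]
  exact add_nonneg (eval_isSumSq_nonneg h₀ x) (Finset.sum_nonneg fun i _ =>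
    mul_nonneg (eval_isSumSq_nonneg (h i) x) (hx i))

theorem truncatedQuadraticModule_mono (g : Fin H → MvPolynomial (Fin d) ℝ) :
    Monotone (truncatedQuadraticModule g) := by
  rintro t t' htt' _ ⟨σ₀, σ, h₀, h, hd₀, hd, rfl⟩
  exact ⟨σ₀, σ, h₀, h, hd₀.trans (by lia), fun i => (hd i).trans (by lia), rfl⟩

theorem exists_mem_truncatedQuadraticModule {g : Fin H → MvPolynomial (Fin d) ℝ}
    {p : MvPolynomial (Fin d) ℝ} (hp : p ∈ quadraticModule g) :
    ∃ t, p ∈ truncatedQuadraticModule g t := by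
  obtain ⟨σ₀, σ, h₀, h, rfl⟩ := hp
  refine ⟨σ₀.totalDegree + Finset.univ.sup fun i => (σ i * g i).totalDegree,
    σ₀, σ, h₀, h, by omega, fun i => ?_, rfl⟩
  have := Finset.le_sup (f := fun i => (σ i * g i).totalDegree) (Finset.mem_univ i)
  omega

theorem antitone_ub (g : Fin H → MvPolynomial (Fin d) ℝ) (n : ℕ) (f : MvPolynomial (Fin d) ℝ) :
    Antitone (ub g n f) := by
  intro t t' htt'
  refine sInf_le_sInf ?_
  rintro _ ⟨c, p, hp, h₁, h₂, rfl⟩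
  exact ⟨c, p, hp, truncatedQuadraticModule_mono g htt' h₁,
    truncatedQuadraticModule_mono g htt' h₂, rfl⟩

theorem bestApproxError_le_ub {g : Fin H → MvPolynomial (Fin d) ℝ}
    (hne : (semialgebraicSet g).Nonempty) (n : ℕ) (f : MvPolynomial (Fin d) ℝ) (t : ℕ) :
    (bestApproxError (n - 1) f (semialgebraicSet g) : EReal) ≤ ub g n f t := by
  refine le_sInf ?_
  rintro _ ⟨c, p, hp, h₁, h₂, rfl⟩
  refine EReal.coe_le_coe_iff.2 (bestApproxError_le_of_abs_le hne hp fun x hx => ?_)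
  have h₁ := eval_nonneg_of_mem_truncatedQuadraticModule h₁ hx
  have h₂ := eval_nonneg_of_mem_truncatedQuadraticModule h₂ hx
  simp only [map_add, map_sub, eval_C] at h₁ h₂
  exact abs_le.2 ⟨by linarith, by linarith⟩

theorem eventually_ub_lt {g : Fin H → MvPolynomial (Fin d) ℝ}
    (hcompact : IsCompact (semialgebraicSet g)) (harch : IsArchimedean g) (n : ℕ)
    (f : MvPolynomial (Fin d) ℝ) {a : EReal}
    (ha : (bestApproxError (n - 1) f (semialgebraicSet g) : EReal) < a) :
    ∀ᶠ t in Filter.atTop, ub g n f t < a := by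
  obtain ⟨c, hc, hca⟩ := EReal.lt_iff_exists_real_btwn.1 ha
  obtain ⟨p, hp, hpc⟩ := exists_uniformNorm_lt (EReal.coe_lt_coe_iff.1 hc)
  have habs : ∀ x ∈ semialgebraicSet g, |eval x f - eval x p| < c := fun x hx => by
    rw [← map_sub]
    exact (abs_eval_le_uniformNorm hcompact _ hx).trans_lt hpc
  have h₁ : C c + f - p ∈ quadraticModule g := mem_quadraticModule_of_pos harch fun x hx => by
    rw [map_sub, map_add, eval_C]
    linarith [(abs_lt.1 (habs x hx)).1]
  have h₂ : C c - f + p ∈ quadraticModule g := mem_quadraticModule_of_pos harch fun x hx => by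
    rw [map_add, map_sub, eval_C]
    linarith [(abs_lt.1 (habs x hx)).2]
  obtain ⟨t₁, ht₁⟩ := exists_mem_truncatedQuadraticModule h₁
  obtain ⟨t₂, ht₂⟩ := exists_mem_truncatedQuadraticModule h₂
  filter_upwards [Filter.eventually_ge_atTop (max t₁ t₂)] with t ht
  refine lt_of_le_of_lt (sInf_le ⟨c, p, hp, ?_, ?_, rfl⟩) hca
  · exact truncatedQuadraticModule_mono g ((le_max_left _ _).trans ht) ht₁
  · exact truncatedQuadraticModule_mono g ((le_max_right _ _).trans ht) ht₂

end SumOfSquaresBound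

/-! ### Degrees of sums of squares -/

section SumOfSquaresDegree

open MonomialOrder

/-- Leading terms with positive coefficients do not cancel. -/
theorem totalDegree_le_add_of_leadingCoeff_nonneg {a b : MvPolynomial (Fin d) ℝ}
    (ha : 0 ≤ degLex.leadingCoeff a) (hb : 0 ≤ degLex.leadingCoeff b) :
    a.totalDegree ≤ (a + b).totalDegree ∧ 0 ≤ degLex.leadingCoeff (a + b) := by
  rcases lt_trichotomy (degLex.toSyn (degLex.degree a)) (degLex.toSyn (degLex.degree b))
    with h | h | h
  · refine ⟨degLex_totalDegree_monotone ?_, ?_⟩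
    · rw [degree_add_eq_right_of_lt h]
      exact h.le
    · rwa [add_comm, leadingCoeff_add_of_lt h]
  · rcases eq_or_ne a 0 with rfl | ha0
    · simpa using hb
    have hab : degLex.degree a = degLex.degree b := degLex.toSyn.injective h
    have hpos : 0 < coeff (degLex.degree a) (a + b) := by
      rw [coeff_add]
      have h1 : 0 < coeff (degLex.degree a) a :=
        lt_of_le_of_ne ha (Ne.symm (degLex.leadingCoeff_ne_zero_iff.2 ha0))
      have h2 : 0 ≤ coeff (degLex.degree a) b := by rw [hab]; exact hb
      linarith
    have hle := degLex.le_degree (mem_support_iff.2 hpos.ne')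
    refine ⟨degLex_totalDegree_monotone hle, ?_⟩
    have hge : degLex.toSyn (degLex.degree (a + b)) ≤ degLex.toSyn (degLex.degree a) := by
      have := degLex.degree_add_le (f := a) (g := b)
      rwa [h, max_self, ← h] at this
    have heq : degLex.degree (a + b) = degLex.degree a :=
      degLex.toSyn.injective (le_antisymm hge hle)
    rw [leadingCoeff, heq]
    exact hpos.le
  · refine ⟨degLex_totalDegree_monotone ?_, ?_⟩
    · rw [degree_add_of_lt h]
    · rwa [leadingCoeff_add_of_lt h]

theorem leadingCoeff_nonneg_of_isSumSq {s : MvPolynomial (Fin d) ℝ} (hs : IsSumSq s) :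
    0 ≤ degLex.leadingCoeff s := by
  induction hs with
  | zero => simp
  | sq_add a _ ih =>
    refine (totalDegree_le_add_of_leadingCoeff_nonneg ?_ ih).2
    rw [leadingCoeff_mul]
    exact mul_self_nonneg _

/-- In a sum of squares of degree at most `2k + 1`, all polynomials that are squared have degree at
most `k`; hence positivity on such squares suffices. -/
theorem nonneg_of_isSumSq (ℓ : MvPolynomial (Fin d) ℝ →ₗ[ℝ] ℝ) (q : MvPolynomial (Fin d) ℝ) {k : ℕ}
    (hℓ : ∀ s : MvPolynomial (Fin d) ℝ, s.totalDegree ≤ k → 0 ≤ ℓ (s * s * q))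
    {σ : MvPolynomial (Fin d) ℝ} (hσ : IsSumSq σ) (hk : σ.totalDegree ≤ 2 * k + 1) :
    0 ≤ ℓ (σ * q) := by
  induction hσ with
  | zero => simp
  | @sq_add a b hb ih =>
    have ha := leadingCoeff_nonneg_of_isSumSq (IsSumSq.mul_self a)
    have hb := leadingCoeff_nonneg_of_isSumSq hb
    have h1 := (totalDegree_le_add_of_leadingCoeff_nonneg ha hb).1
    have h2 := (totalDegree_le_add_of_leadingCoeff_nonneg hb ha).1
    rw [add_comm b] at h2
    rw [add_mul, map_add]
    refine add_nonneg (hℓ a ?_) (ih (h2.trans hk))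
    rcases eq_or_ne a 0 with rfl | ha0
    · simp
    · rw [totalDegree_mul_of_isDomain ha0 ha0] at h1
      omega

end SumOfSquaresDegree

/-! ### The moment program -/

section Moments

/-- The linear functional on polynomials with moments `y`. -/
noncomputable def momentFunctional (y : (Fin d →₀ ℕ) → ℝ) : MvPolynomial (Fin d) ℝ →ₗ[ℝ] ℝ :=
  (basisMonomials (Fin d) ℝ).constr ℝ y

theorem momentFunctional_monomial (y : (Fin d →₀ ℕ) → ℝ) (l : Fin d →₀ ℕ) (c : ℝ) :
    momentFunctional y (monomial l c) = c * y l := by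
  have h := (basisMonomials (Fin d) ℝ).constr_basis ℝ y l
  rw [coe_basisMonomials] at h
  rw [← mul_one c, ← smul_eq_mul c 1, ← smul_monomial, map_smul, momentFunctional, h]
  simp

theorem linearMap_apply_eq_sum (ℓ : MvPolynomial (Fin d) ℝ →ₗ[ℝ] ℝ)
    (p : MvPolynomial (Fin d) ℝ) :
    ℓ p = ∑ l ∈ p.support, coeff l p * ℓ (monomial l 1) := by
  conv_lhs => rw [← support_sum_monomial_coeff p, map_sum]
  refine Finset.sum_congr rfl fun l _ => ?_
  rw [← smul_eq_mul, ← map_smul, smul_monomial, smul_eq_mul, mul_one]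

theorem momentFunctional_apply (y : (Fin d →₀ ℕ) → ℝ) (p : MvPolynomial (Fin d) ℝ) :
    momentFunctional y p = ∑ l ∈ p.support, coeff l p * y l := by
  simp only [linearMap_apply_eq_sum _ p, momentFunctional_monomial, one_mul]

theorem momentFunctional_shift (q : MvPolynomial (Fin d) ℝ) (y : (Fin d →₀ ℕ) → ℝ)
    (p : MvPolynomial (Fin d) ℝ) :
    momentFunctional (shift q y) p = momentFunctional y (p * q) := by
  have : momentFunctional (shift q y) =
      momentFunctional y ∘ₗ LinearMap.mulRight ℝ q := by
    refine (basisMonomials (Fin d) ℝ).ext fun l => ?_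
    rw [coe_basisMonomials, momentFunctional_monomial, one_mul, LinearMap.comp_apply,
      LinearMap.mulRight_apply]
    conv_rhs => rw [← support_sum_monomial_coeff q, Finset.mul_sum, map_sum]
    simp only [monomial_mul, one_mul, momentFunctional_monomial, shift]
  rw [this]
  rfl

theorem hankel_posSemidef_iff (t : ℕ) (y : (Fin d →₀ ℕ) → ℝ) :
    (hankel t y).PosSemidef ↔
      ∀ s : MvPolynomial (Fin d) ℝ, s.totalDegree ≤ t → 0 ≤ momentFunctional y (s * s) := by
  -- the quadratic form of the Hankel matrix at a vector is the functional at a square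
  have key : ∀ x : {i : Fin d →₀ ℕ // i.degree ≤ t} →₀ ℝ,
      (x.sum fun i xi => x.sum fun j xj => star xi * hankel t y i j * xj) =
        momentFunctional y
          ((x.sum fun i xi => monomial i.1 xi) * x.sum fun i xi => monomial i.1 xi) := by
    intro x
    simp only [Finsupp.sum, Finset.sum_mul_sum, map_sum, monomial_mul, momentFunctional_monomial,
      hankel, Matrix.of_apply, star_trivial]
    exact Finset.sum_congr rfl fun i _ => Finset.sum_congr rfl fun j _ => by ring
  constructor
  · intro h s hs
    let x : {i : Fin d →₀ ℕ // i.degree ≤ t} →₀ ℝ :=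
      Finsupp.onFinset (s.support.subtype _) (fun i => coeff i.1 s) (by simp)
    have hx : (x.sum fun i xi => monomial i.1 xi) = s := by
      rw [Finsupp.onFinset_sum _ (by simp)]
      rw [Finset.sum_subtype_of_mem (p := fun i => i.degree ≤ t) (fun i => monomial i (coeff i s))
        (fun i hi => (le_totalDegree hi).trans hs)]
      exact support_sum_monomial_coeff s
    have := h.2 x
    rwa [key, hx] at this
  · intro h
    refine ⟨Matrix.IsHermitian.ext fun i j => ?_, fun x => ?_⟩
    · simp [hankel, add_comm]
    · rw [key]
      refine h _ (totalDegree_finsetSum_le fun i _ => ?_)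
      exact (totalDegree_monomial_le _ _).trans i.2

/-- Pseudo-moments of order `2t` are the moments of the functionals that are nonnegative on the
squares, and on the squares times `g h`, whose degrees fit in `2t`. -/
theorem isPseudoMoment_iff (g : Fin H → MvPolynomial (Fin d) ℝ) (t : ℕ)
    (y : (Fin d →₀ ℕ) → ℝ) :
    IsPseudoMoment g t y ↔ (∀ l, 2 * t < l.degree → y l = 0) ∧
      (∀ s : MvPolynomial (Fin d) ℝ, s.totalDegree ≤ t → 0 ≤ momentFunctional y (s * s)) ∧
      ∀ h, ∀ s : MvPolynomial (Fin d) ℝ, s.totalDegree ≤ t - halfDegree (g h) →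
        0 ≤ momentFunctional y (s * s * g h) := by
  simp only [IsPseudoMoment, hankel_posSemidef_iff, momentFunctional_shift]

/-- The moments of order at most `2t` of a linear functional, extended by zero. -/
noncomputable def truncatedMoments (t : ℕ) (ℓ : MvPolynomial (Fin d) ℝ →ₗ[ℝ] ℝ) :
    (Fin d →₀ ℕ) → ℝ :=
  fun l => if l.degree ≤ 2 * t then ℓ (monomial l 1) else 0

theorem momentFunctional_truncatedMoments {t : ℕ} (ℓ : MvPolynomial (Fin d) ℝ →ₗ[ℝ] ℝ)
    {p : MvPolynomial (Fin d) ℝ} (hp : p.totalDegree ≤ 2 * t) :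
    momentFunctional (truncatedMoments t ℓ) p = ℓ p := by
  rw [momentFunctional_apply, linearMap_apply_eq_sum ℓ]
  refine Finset.sum_congr rfl fun l hl => ?_
  have hdeg : l.degree ≤ 2 * t := (le_totalDegree hl).trans hp
  rw [truncatedMoments, if_pos hdeg]

theorem isPseudoMoment_truncatedMoments {g : Fin H → MvPolynomial (Fin d) ℝ} {t : ℕ}
    (ht : ∀ h, halfDegree (g h) ≤ t) {ℓ : MvPolynomial (Fin d) ℝ →ₗ[ℝ] ℝ}
    (h₀ : ∀ s : MvPolynomial (Fin d) ℝ, s.totalDegree ≤ t → 0 ≤ ℓ (s * s))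
    (h₁ : ∀ h, ∀ s : MvPolynomial (Fin d) ℝ, s.totalDegree ≤ t - halfDegree (g h) →
        0 ≤ ℓ (s * s * g h)) :
    IsPseudoMoment g t (truncatedMoments t ℓ) := by
  refine (isPseudoMoment_iff g t _).2 ⟨fun l hl => if_neg hl.not_ge, fun s hs => ?_,
    fun h s hs => ?_⟩
  · have := totalDegree_mul s s
    rw [momentFunctional_truncatedMoments ℓ (by omega)]
    exact h₀ s hs
  · have h2 := totalDegree_mul s s
    have h3 := totalDegree_mul (s * s) (g h)
    have h4 := ht h
    have h5 : (g h).totalDegree ≤ 2 * halfDegree (g h) := by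
      rw [halfDegree]; omega
    rw [momentFunctional_truncatedMoments ℓ (by omega)]
    exact h₁ h s hs

theorem momentFunctional_nonneg {g : Fin H → MvPolynomial (Fin d) ℝ} {t : ℕ}
    {y : (Fin d →₀ ℕ) → ℝ} (hy : IsPseudoMoment g t y) {p : MvPolynomial (Fin d) ℝ}
    (hp : p ∈ truncatedQuadraticModule g t) : 0 ≤ momentFunctional y p := by
  obtain ⟨-, h₀, h₁⟩ := (isPseudoMoment_iff g t y).1 hy
  obtain ⟨σ₀, σ, hσ₀, hσ, hd₀, hd, rfl⟩ := hp
  rw [map_add, map_sum]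
  refine add_nonneg ?_ (Finset.sum_nonneg fun h _ => ?_)
  · have := nonneg_of_isSumSq (momentFunctional y) 1 (k := t)
      (fun s hs => by rw [mul_one]; exact h₀ s hs) hσ₀ (hd₀.trans (by lia))
    rwa [mul_one] at this
  · rcases eq_or_ne (σ h) 0 with hs0 | hs0
    · simp [hs0]
    rcases eq_or_ne (g h) 0 with hg0 | hg0
    · simp [hg0]
    have hdeg := hd h
    rw [totalDegree_mul_of_isDomain hs0 hg0] at hdeg
    refine nonneg_of_isSumSq (momentFunctional y) (g h) (k := t - halfDegree (g h)) (h₁ h) (hσ h) ?_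
    -- for odd `deg (g h)` the degree bound for `σ h` is `2 (t - halfDegree (g h)) + 1`
    rw [halfDegree]
    lia

theorem momentFunctional_eq_of_forall_le {n : ℕ} {y z : (Fin d →₀ ℕ) → ℝ}
    (h : ∀ l : Fin d →₀ ℕ, l.degree ≤ n → y l - z l = 0) {p : MvPolynomial (Fin d) ℝ}
    (hp : p.totalDegree ≤ n) : momentFunctional y p = momentFunctional z p := by
  simp only [momentFunctional_apply]
  refine Finset.sum_congr rfl fun l hl => ?_
  rw [sub_eq_zero.1 (h l ((le_totalDegree hl).trans hp))]

theorem sum_coeff_mul_sub_eq (f : MvPolynomial (Fin d) ℝ) (y z : (Fin d →₀ ℕ) → ℝ) :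
    ∑ l ∈ f.support, f.coeff l * (y l - z l) = momentFunctional y f - momentFunctional z f := by
  simp only [momentFunctional_apply, mul_sub, Finset.sum_sub_distrib]

/-- Weak duality: a feasible pair of pseudo-moments is applied to the two certificates of a
feasible `c`, crosswise. -/
theorem ub'_le_ub (g : Fin H → MvPolynomial (Fin d) ℝ) (n : ℕ) (f : MvPolynomial (Fin d) ℝ)
    (t : ℕ) : ub' g n f t ≤ ub g n f t := by
  refine sSup_le ?_
  rintro _ ⟨yp, ym, hy, h1, hyp, hym, rfl⟩
  refine le_sInf ?_
  rintro _ ⟨c, p, hp, hc₁, hc₂, rfl⟩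
  have h₁ := momentFunctional_nonneg hym hc₁
  have h₂ := momentFunctional_nonneg hyp hc₂
  have h₃ := momentFunctional_eq_of_forall_le hy ((mem_restrictTotalDegree _ _ _).1 hp)
  have hC : ∀ y : (Fin d →₀ ℕ) → ℝ, momentFunctional y (C c) = c * y 0 := fun y =>
    momentFunctional_monomial y 0 c
  simp only [map_add, map_sub, hC] at h₁ h₂
  rw [sum_coeff_mul_sub_eq, EReal.coe_le_coe_iff]
  have h₄ : c * yp 0 + c * ym 0 = c := by rw [← mul_add, h1, mul_one]
  linarith

/-- A pair of functionals with the positivity required at level `t` is feasible for the moment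
program, by truncation. -/
theorem le_ub'_of_functionals {g : Fin H → MvPolynomial (Fin d) ℝ} {n : ℕ}
    {f : MvPolynomial (Fin d) ℝ} {t : ℕ} (hf : f.totalDegree ≤ 2 * t) (hn : n - 1 ≤ 2 * t)
    {ℓp ℓm : MvPolynomial (Fin d) ℝ →ₗ[ℝ] ℝ}
    (hp : IsPseudoMoment g t (truncatedMoments t ℓp))
    (hm : IsPseudoMoment g t (truncatedMoments t ℓm))
    (hone : ℓp 1 + ℓm 1 = 1)
    (heq : ∀ p ∈ restrictTotalDegree (Fin d) ℝ (n - 1), ℓp p = ℓm p) :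
    ((ℓp f - ℓm f : ℝ) : EReal) ≤ ub' g n f t := by
  refine le_sSup ⟨_, _, fun l hl => ?_, ?_, hp, hm, ?_⟩
  · rw [truncatedMoments, truncatedMoments, if_pos (hl.trans hn), if_pos (hl.trans hn), heq,
      sub_self]
    exact (mem_restrictTotalDegree _ _ _).2 ((totalDegree_monomial_le _ _).trans hl)
  · rw [truncatedMoments, truncatedMoments, if_pos (by simp), if_pos (by simp)]
    exact hone
  · rw [sum_coeff_mul_sub_eq, momentFunctional_truncatedMoments ℓp hf,
      momentFunctional_truncatedMoments ℓm hf]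

theorem isPseudoMoment_truncatedMoments_of_le {g : Fin H → MvPolynomial (Fin d) ℝ} {t t' : ℕ}
    (ht : ∀ h, halfDegree (g h) ≤ t) (htt' : t ≤ t') {y : (Fin d →₀ ℕ) → ℝ}
    (hy : IsPseudoMoment g t' y) :
    IsPseudoMoment g t (truncatedMoments t (momentFunctional y)) := by
  obtain ⟨-, h₀, h₁⟩ := (isPseudoMoment_iff g t' y).1 hy
  exact isPseudoMoment_truncatedMoments ht (fun s hs => h₀ s (hs.trans htt'))
    fun h s hs => h₁ h s (hs.trans (by lia))

theorem ub'_le_ub'_of_le {g : Fin H → MvPolynomial (Fin d) ℝ} {n : ℕ}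
    {f : MvPolynomial (Fin d) ℝ} {t t' : ℕ} (hf : f.totalDegree ≤ 2 * t) (hn : n - 1 ≤ 2 * t)
    (ht : ∀ h, halfDegree (g h) ≤ t) (htt' : t ≤ t') : ub' g n f t' ≤ ub' g n f t := by
  refine sSup_le ?_
  rintro _ ⟨yp, ym, hy, h1, hyp, hym, rfl⟩
  rw [sum_coeff_mul_sub_eq]
  refine le_ub'_of_functionals hf hn (isPseudoMoment_truncatedMoments_of_le ht htt' hyp)
    (isPseudoMoment_truncatedMoments_of_le ht htt' hym) ?_ fun p hp =>
      momentFunctional_eq_of_forall_le hy ((mem_restrictTotalDegree _ _ _).1 hp)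
  have hone : ∀ y : (Fin d →₀ ℕ) → ℝ, momentFunctional y 1 = y 0 := fun y => by
    rw [← one_mul (y 0)]
    exact momentFunctional_monomial y 0 1
  rw [hone, hone, h1]

theorem bestApproxError_le_ub' {g : Fin H → MvPolynomial (Fin d) ℝ}
    (hcompact : IsCompact (semialgebraicSet g)) (hne : (semialgebraicSet g).Nonempty) {n : ℕ}
    {f : MvPolynomial (Fin d) ℝ} {t : ℕ} (hf : f.totalDegree ≤ 2 * t) (hn : n - 1 ≤ 2 * t)
    (ht : ∀ h, halfDegree (g h) ≤ t) :
    (bestApproxError (n - 1) f (semialgebraicSet g) : EReal) ≤ ub' g n f t := by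
  obtain ⟨Lp, Lm, hLp, hLm, hone, heq, hE⟩ :=
    exists_extremal_functionals hcompact hne (n - 1) f
  have key : ∀ L : MvPolynomial (Fin d) ℝ →ₗ[ℝ] ℝ,
      (∀ q, (∀ x ∈ semialgebraicSet g, 0 ≤ eval x q) → 0 ≤ L q) →
      IsPseudoMoment g t (truncatedMoments t L) := fun L hL =>
    isPseudoMoment_truncatedMoments ht
      (fun s _ => hL _ fun x _ => by
        rw [map_mul]; exact mul_self_nonneg _)
      (fun h s _ => hL _ fun x hx => by
        rw [map_mul, map_mul]; exact mul_nonneg (mul_self_nonneg _) (hx h))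
  exact (EReal.coe_le_coe_iff.2 hE).trans
    (le_ub'_of_functionals hf hn (key Lp hLp) (key Lm hLm) hone heq)

end Moments

end ChebyshevSOS

theorem theorem3p2 {d H : ℕ} (g : Fin H → MvPolynomial (Fin d) ℝ)
    (hcompact : IsCompact (ChebyshevSOS.semialgebraicSet g))
    (hinterior : (interior (ChebyshevSOS.semialgebraicSet g)).Nonempty)
    (harch : ChebyshevSOS.IsArchimedean g)
    (n N : ℕ) (hn : 1 ≤ n) (hN : n ≤ N)
    (f : MvPolynomial (Fin d) ℝ) (hf : f ∈ MvPolynomial.restrictTotalDegree (Fin d) ℝ N) :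
    let E : ℝ := ChebyshevSOS.bestApproxError (n - 1) f (ChebyshevSOS.semialgebraicSet g)
    let t₀ : ℕ := N + Finset.univ.sup fun h => ChebyshevSOS.halfDegree (g h)
    (AntitoneOn (ChebyshevSOS.ub g n f) (Set.Ici t₀) ∧
      ∀ t, t₀ ≤ t → (E : EReal) ≤ ChebyshevSOS.ub g n f t) ∧
    (AntitoneOn (ChebyshevSOS.ub' g n f) (Set.Ici t₀) ∧
      ∀ t, t₀ ≤ t → (E : EReal) ≤ ChebyshevSOS.ub' g n f t) ∧
    Filter.Tendsto (ChebyshevSOS.ub g n f) Filter.atTop (𝓝 (E : EReal)) ∧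
    Filter.Tendsto (ChebyshevSOS.ub' g n f) Filter.atTop (𝓝 (E : EReal)) := by
  intro E t₀
  have hne := hinterior.mono interior_subset
  rw [MvPolynomial.mem_restrictTotalDegree] at hf
  have hfN : ∀ t, t₀ ≤ t → f.totalDegree ≤ 2 * t := fun t ht => by lia
  have hnN : ∀ t, t₀ ≤ t → n - 1 ≤ 2 * t := fun t ht => by lia
  have hhalf : ∀ t, t₀ ≤ t → ∀ h, ChebyshevSOS.halfDegree (g h) ≤ t := fun t ht h =>
    (Finset.le_sup (f := fun h => ChebyshevSOS.halfDegree (g h)) (Finset.mem_univ h)).trans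
      ((Nat.le_add_left _ N).trans ht)
  have hub : ∀ t, (E : EReal) ≤ ChebyshevSOS.ub g n f t :=
    ChebyshevSOS.bestApproxError_le_ub hne n f
  have hub' : ∀ t, t₀ ≤ t → (E : EReal) ≤ ChebyshevSOS.ub' g n f t := fun t ht =>
    ChebyshevSOS.bestApproxError_le_ub' hcompact hne (hfN t ht) (hnN t ht) (hhalf t ht)
  have hlim : Filter.Tendsto (ChebyshevSOS.ub g n f) Filter.atTop (𝓝 (E : EReal)) :=
    tendsto_order.2 ⟨fun a ha => .of_forall fun t => ha.trans_le (hub t),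
      fun a ha => ChebyshevSOS.eventually_ub_lt hcompact harch n f ha⟩
  refine ⟨⟨(ChebyshevSOS.antitone_ub g n f).antitoneOn _, fun t _ => hub t⟩,
    ⟨fun t ht t' _ htt' => ChebyshevSOS.ub'_le_ub'_of_le (hfN t ht) (hnN t ht) (hhalf t ht) htt',
      hub'⟩, hlim, ?_⟩
  exact tendsto_of_tendsto_of_tendsto_of_le_of_le' tendsto_const_nhds hlim
    (Filter.eventually_atTop.2 ⟨t₀, hub'⟩)
    (.of_forall fun t => ChebyshevSOS.ub'_le_ub g n f t)
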